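/- Let $n,m$ be integers with $2\le n\le |m|$, let $\Gamma:=\operatorname{BS}(n,m)=\langle a,b\mid ba^nb^{-1}=a^m\rangle$, and let $\Gamma\curvearrowright(X,\mu)$ be a probability measure preserving action on a standard probability space. Put $k=\gcd(n,m)$, $n_0=n/k$, $m_0=m/k$ and $$\mathcal F:=\{k\,|n_0|^s|m_0|^t \mid s,t\in\mathbb N=\{0,1,2,\dots\},\ s+t>0\}.$$ Let $\Lambda:=\operatorname{QC}_\Gamma(\langle a\rangle)=\bigcup_{L} \operatorname{C}_\Gamma(L)$ be the quasi-centralizer of $\langle a\rangle$, where $L$ runs over the finite index subgroups of $\langle a\rangle$ and $\operatorname{C}_\Gamma(L)$ is the centralizer of $L$ in $\Gamma$. Let $M:=L^\infty(X)\rtimes\Gamma$ be the crossed product von Neumann algebra and, for every nonzero integer $z$, let $N_z:=L^\infty(X)\rtimes\langle a^z\rangle\subset M$. The following statements are equivalent. 1. $N_z'\cap M=\mathbb C1$ for every $z\in\mathcal F$. 2. $\Lambda\curvearrowright X$ is essentially free and $\langle a^z\rangle\curvearrowright X$ is ergodic for every $z\in\mathcal F$. 3. $\Gamma\curvearrowright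 X$ is essentially free and $\langle a^z\rangle\curvearrowright X$ is ergodic for every $z\in\mathcal F$. Here an action of a subgroup of $\Gamma$ on $(X,\mu)$ is called essentially free if $\mu(\{x\in X\mid gx=x\})=0$ for every element $g\ne e$ of that subgroup. -/

import Mathlib

open MeasureTheory
open scoped ENNReal

/-- The Baumslag-Solitar group `BS(n, m) = ⟨a, b ∣ b aⁿ b⁻¹ = aᵐ⟩`; the free generator `0` is `a`
and the free generator `1` is `b`. -/
abbrev BaumslagSolitar (n m : ℤ) : Type :=
  PresentedGroup ({FreeGroup.of 1 * FreeGroup.of 0 ^ n * (FreeGroup.of 1)⁻¹ *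
    (FreeGroup.of 0 ^ m)⁻¹} : Set (FreeGroup (Fin 2)))

/-- The generator `a` of `BS(n, m)`. -/
def BaumslagSolitar.a (n m : ℤ) : BaumslagSolitar n m := PresentedGroup.of 0

/-- The set `𝓕 = {k |n₀|ˢ |m₀|ᵗ ∣ s, t ∈ ℕ, s + t > 0}`, where `k = gcd(n, m)`, `n₀ = n / k` and
`m₀ = m / k` (the divisions are exact). -/
def indexSet (n m : ℤ) : Set ℕ :=
  {z | ∃ s t : ℕ, 0 < s + t ∧
    z = Int.gcd n m * (n / (Int.gcd n m : ℤ)).natAbs ^ s * (m / (Int.gcd n m : ℤ)).natAbs ^ t}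

/-- The quasi-centralizer of a subgroup `L` of a group `G`: the union of the centralizers in `G`
of all finite index subgroups of `L`. -/
def quasiCentralizer {G : Type*} [Group G] (L : Subgroup G) : Subgroup G where
  carrier := {g | ∃ L₁ : Subgroup G, L₁ ≤ L ∧ L₁.relIndex L ≠ 0 ∧
    g ∈ Subgroup.centralizer (L₁ : Set G)}
  one_mem' := ⟨L, le_rfl, by simp, one_mem _⟩
  mul_mem' := by
    rintro g h ⟨L₁, h₁, i₁, c₁⟩ ⟨L₂, h₂, i₂, c₂⟩
    exact ⟨L₁ ⊓ L₂, inf_le_left.trans h₁, Subgroup.relIndex_inf_ne_zero i₁ i₂,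
      mul_mem (Subgroup.centralizer_le (fun _ hx => hx.1) c₁)
        (Subgroup.centralizer_le (fun _ hx => hx.2) c₂)⟩
  inv_mem' := by
    rintro g ⟨L₁, h₁, i₁, c₁⟩
    exact ⟨L₁, h₁, i₁, inv_mem c₁⟩

/-- An action of a (countable) group `G` on a measure space `(X, μ)` is essentially free if the
fixed point set of every nontrivial group element is a null set. -/
def EssentiallyFree (G : Type*) {X : Type*} [Group G] [MulAction G X] [MeasurableSpace X]
    (μ : Measure X) : Prop :=
  ∀ g : G, g ≠ 1 → μ (MulAction.fixedBy X g) = 0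

/-- The von Neumann algebra generated by a set `S` of bounded operators on a Hilbert space:
the double commutant of `S ∪ S*`. -/
noncomputable def generatedVonNeumannAlgebra {H : Type*} [NormedAddCommGroup H]
    [InnerProductSpace ℂ H] [CompleteSpace H] (S : Set (H →L[ℂ] H)) : VonNeumannAlgebra H where
  toStarSubalgebra :=
    StarSubalgebra.centralizer ℂ (StarSubalgebra.centralizer ℂ S : Set (H →L[ℂ] H))
  centralizer_centralizer' := by
    change Set.centralizer (Set.centralizer (Set.centralizer _)) = Set.centralizer _
    simp

namespace CrossedProduct

section TensorTranslation

variable {G : Type*} [Group G] {E : Type*} [NormedAddCommGroup E] [InnerProductSpace ℂ E]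

theorem summable_translate {E : Type*} [NormedAddCommGroup E] (h : G)
    (ξ : lp (fun _ : G => E) 2) :
    Summable fun g : G => ‖ξ (h⁻¹ * g)‖ ^ (2 : ℝ≥0∞).toReal :=
  (Equiv.mulLeft h⁻¹).summable_iff.2 ((lp.memℓp ξ).summable (by norm_num))

theorem norm_rpow_two_le (T : E →L[ℂ] E) (x : E) :
    ‖T x‖ ^ (2 : ℝ≥0∞).toReal ≤ ‖T‖ ^ (2 : ℝ≥0∞).toReal * ‖x‖ ^ (2 : ℝ≥0∞).toReal := by
  rw [← Real.mul_rpow (norm_nonneg _) (norm_nonneg _)]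
  exact Real.rpow_le_rpow (norm_nonneg _) (T.le_opNorm _) (by norm_num)

theorem memlp_tensorTranslation (T : E →L[ℂ] E) (h : G) (ξ : lp (fun _ : G => E) 2) :
    Memℓp (fun g : G => T (ξ (h⁻¹ * g))) 2 :=
  memℓp_gen (Summable.of_nonneg_of_le (fun _ => by positivity)
    (fun g => norm_rpow_two_le T _) ((summable_translate h ξ).mul_left _))

/-- The linear map underlying `tensorTranslation`. -/
noncomputable def tensorTranslationₗ (T : E →L[ℂ] E) (h : G) :
    lp (fun _ : G => E) 2 →ₗ[ℂ] lp (fun _ : G => E) 2 where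
  toFun ξ := ⟨fun g => T (ξ (h⁻¹ * g)), memlp_tensorTranslation T h ξ⟩
  map_add' ξ η := by
    ext g
    exact map_add T (ξ (h⁻¹ * g)) (η (h⁻¹ * g))
  map_smul' c ξ := by
    ext g
    exact map_smul T c (ξ (h⁻¹ * g))

theorem norm_tensorTranslationₗ_le (T : E →L[ℂ] E) (h : G) (ξ : lp (fun _ : G => E) 2) :
    ‖tensorTranslationₗ T h ξ‖ ≤ ‖T‖ * ‖ξ‖ := by
  refine lp.norm_le_of_tsum_le (by norm_num) (by positivity) ?_
  have h1 : ∑' g : G, ‖ξ (h⁻¹ * g)‖ ^ (2 : ℝ≥0∞).toReal = ‖ξ‖ ^ (2 : ℝ≥0∞).toReal := by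
    rw [lp.norm_rpow_eq_tsum (by norm_num) ξ]
    exact (Equiv.mulLeft h⁻¹).tsum_eq (fun g => ‖ξ g‖ ^ (2 : ℝ≥0∞).toReal)
  rw [Real.mul_rpow (norm_nonneg _) (norm_nonneg _), ← h1, ← tsum_mul_left]
  exact ((memlp_tensorTranslation T h ξ).summable (by norm_num)).tsum_le_tsum
    (fun g => norm_rpow_two_le T (ξ (h⁻¹ * g))) ((summable_translate h ξ).mul_left _)

/-- For a Hilbert space `E` and a group `G`, the space `lp (fun _ : G => E) 2` of square summable
families is the Hilbert space `E ⊗ ℓ²(G)`. For a bounded operator `T` on `E` and `h` in `G`, this is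
the operator `T ⊗ λ_h`, where `λ` is the left regular representation:
`((T ⊗ λ_h) ξ) g = T (ξ (h⁻¹ g))`. -/
noncomputable def tensorTranslation (T : E →L[ℂ] E) (h : G) :
    lp (fun _ : G => E) 2 →L[ℂ] lp (fun _ : G => E) 2 :=
  (tensorTranslationₗ T h).mkContinuous ‖T‖ (norm_tensorTranslationₗ_le T h)

@[simp]
theorem tensorTranslation_apply (T : E →L[ℂ] E) (h g : G) (ξ : lp (fun _ : G => E) 2) :
    tensorTranslation T h ξ g = T (ξ (h⁻¹ * g)) := rfl

end TensorTranslation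

variable {G : Type*} [Group G] {X : Type*} [MeasurableSpace X] [MulAction G X]

/-- Multiplication by `f ∈ L^∞(X, μ)` as an operator on `L²(X, μ)`. -/
noncomputable def mulOp {μ : Measure X} (f : Lp ℂ ∞ μ) : Lp ℂ 2 μ →L[ℂ] Lp ℂ 2 μ :=
  (ContinuousLinearMap.mul ℂ ℂ).holderL μ ∞ 2 2 f

/-- The Koopman representation on `L²(X, μ)`: `(σ_h ξ) x = ξ (h⁻¹ x)`. -/
noncomputable def koopman (μ : Measure X) [MeasurableConstSMul G X] [SMulInvariantMeasure G X μ]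
    (h : G) : Lp ℂ 2 μ →L[ℂ] Lp ℂ 2 μ :=
  (Lp.compMeasurePreservingₗᵢ ℂ (fun x : X => h⁻¹ • x)
    (measurePreserving_smul h⁻¹ μ)).toContinuousLinearMap

/-- The Hilbert space `L²(X, μ) ⊗ ℓ²(G)` on which the crossed product `L^∞(X, μ) ⋊ G` acts. -/
abbrev HilbertSpace (G : Type*) {X : Type*} [MeasurableSpace X] (μ : Measure X) : Type _ :=
  lp (fun _ : G => Lp ℂ 2 μ) 2

/-- The copy `f ⊗ 1` of `f ∈ L^∞(X, μ)` in the crossed product. -/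
noncomputable def coeff (G : Type*) [Group G] {X : Type*} [MeasurableSpace X] {μ : Measure X}
    (f : Lp ℂ ∞ μ) : HilbertSpace G μ →L[ℂ] HilbertSpace G μ :=
  tensorTranslation (mulOp f) (1 : G)

/-- The canonical unitary `u_h = σ_h ⊗ λ_h` of the crossed product; it satisfies
`u_h f u_h* = f(h⁻¹ ·)`. -/
noncomputable def canonicalUnitary (μ : Measure X) [MeasurableConstSMul G X]
    [SMulInvariantMeasure G X μ] (h : G) : HilbertSpace G μ →L[ℂ] HilbertSpace G μ :=
  tensorTranslation (koopman μ h) h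

/-- For a probability measure preserving action of `G` on `(X, μ)` and a subgroup `L` of `G`, the
von Neumann subalgebra `L^∞(X, μ) ⋊ L` of `L^∞(X, μ) ⋊ G`: the von Neumann algebra generated by
`L^∞(X, μ)` and the canonical unitaries `u_h` with `h` in `L`. For `L = ⊤` it is the crossed product
`L^∞(X, μ) ⋊ G` itself. -/
noncomputable def crossedProduct (μ : Measure X) [MeasurableConstSMul G X]
    [SMulInvariantMeasure G X μ] (L : Subgroup G) : VonNeumannAlgebra (HilbertSpace G μ) :=
  generatedVonNeumannAlgebra
    (Set.range (coeff G (μ := μ)) ∪ {T | ∃ h ∈ L, T = canonicalUnitary μ h})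

end CrossedProduct

/-!
`2 → 3`: if `g` is outside the quasi-centralizer `Λ` of `⟨a⟩`, then `⟨a⟩` has infinitely many cosets
modulo the elements commuting with `g`. As `⟨a⟩` is commensurated by `BS(n, m)`, for `u` and `v` in
distinct cosets the element `(u g u⁻¹)⁻¹ (v g v⁻¹)` is a nontrivial element of `Λ` fixing
`Fix (u g u⁻¹) ∩ Fix (v g v⁻¹)`. So essential freeness of `Λ` makes infinitely many translates of
`Fix g` pairwise disjoint up to null sets, and `Fix g` is null.

`3 → 1`: an element `T` of `N_z' ∩ M` is determined by its Fourier coefficients `ξ_g = (T Ω)_g`,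
where `Ω = 1 ⊗ δ₁`. Commutation with `L^∞(X)` forces `ξ_g` to be supported on `Fix g`, and
commutation with `u_h` for `h` in `⟨a^z⟩` makes `ξ_1` invariant under `h`, hence constant.

`1 → 2`: if `E` is invariant under `⟨a^z⟩`, then `1_E` belongs to `N_z' ∩ M`, and if `g` in `Λ`
commutes with `a^z`, then so does `1_{Fix g} u_g`. Such a `z` exists in `𝓕`: conjugation by a word
of length `d` maps `⟨a^(k (n₀ m₀)^(d + 1))⟩` into `⟨a⟩`, and an element commuting with some nonzero
power of `a` commutes with every power of `a` that it conjugates into `⟨a⟩`.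
-/

section QuasiCentralizer

variable {G : Type*} [Group G] {A : Subgroup G} {g w : G}

theorem mem_quasiCentralizer_iff_relIndex_ne_zero :
    g ∈ quasiCentralizer A ↔ (Subgroup.centralizer {g}).relIndex A ≠ 0 := by
  constructor
  · rintro ⟨L, -, hL, hg⟩
    refine ne_zero_of_dvd_ne_zero hL (Subgroup.relIndex_dvd_of_le_left A ?_)
    exact fun x hx => Subgroup.mem_centralizer_singleton_iff.2
      (Subgroup.mem_centralizer_iff.1 hg x hx)
  · intro h
    refine ⟨Subgroup.centralizer {g} ⊓ A, inf_le_right, by rwa [Subgroup.inf_relIndex_right],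
      Subgroup.mem_centralizer_iff.2 fun x hx => Subgroup.mem_centralizer_singleton_iff.1 hx.1⟩

theorem le_quasiCentralizer [IsMulCommutative A] : A ≤ quasiCentralizer A := fun _ hg =>
  ⟨A, le_rfl, by simp, Subgroup.mem_centralizer_iff.2 fun _ hx => setLike_mul_comm hx hg⟩

open scoped Pointwise in
theorem inv_mul_mul_mul_inv_mem_quasiCentralizer [IsMulCommutative A]
    (hg : g ∈ Subgroup.Commensurable.commensurator A) (hw : w ∈ A) :
    g⁻¹ * w * g * w⁻¹ ∈ quasiCentralizer A := by
  have hconj := (Subgroup.Commensurable.commensurator_mem_iff A g⁻¹).1 (inv_mem hg)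
  refine ⟨ConjAct.toConjAct g⁻¹ • A ⊓ A, inf_le_right,
    by simpa only [Subgroup.inf_relIndex_right] using hconj.1, Subgroup.mem_centralizer_iff.2 ?_⟩
  rintro x ⟨hx, hxA⟩
  have hgx : Commute w (g * x * g⁻¹) := setLike_mul_comm hw <| by
    simpa only [ConjAct.toConjAct_inv, inv_inv, ConjAct.toConjAct_smul] using
      Subgroup.mem_pointwise_smul_iff_inv_smul_mem.1 hx
  have hx₁ : Commute (g⁻¹ * w * g) x := by
    rw [← Commute.conj_iff g]
    simpa only [mul_assoc, mul_inv_cancel_left, mul_inv_cancel, mul_one] using hgx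
  have hx₂ : Commute w x := setLike_mul_comm hw hxA
  exact (hx₁.mul_left hx₂.inv_left).symm

end QuasiCentralizer

section EssentiallyFree

variable {G : Type*} [Group G] {X : Type*} [MulAction G X] [MeasurableSpace X]

theorem measurableSet_fixedBy [MeasurableSpace.CountablySeparated X] [MeasurableConstSMul G X]
    (g : G) : MeasurableSet (MulAction.fixedBy X g) := by
  obtain ⟨f, hf, hinj⟩ := MeasurableSpace.measurable_injection_nat_bool_of_countablySeparated X
  simpa only [Function.comp_apply, hinj.eq_iff, MulAction.fixedBy] using
    measurableSet_eq_fun (hf.comp (measurable_const_smul g)) hf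

variable {μ : Measure X} {A : Subgroup G}

theorem EssentiallyFree.measure_fixedBy_eq_zero {g : G} (h : EssentiallyFree A μ) (hg : g ∈ A)
    (h1 : g ≠ 1) : μ (MulAction.fixedBy X g) = 0 :=
  h ⟨g, hg⟩ fun h => h1 (congrArg Subtype.val h)

theorem EssentiallyFree.aedisjoint_fixedBy_conj [IsMulCommutative A]
    (hfree : EssentiallyFree (quasiCentralizer A) μ) {g u v : G}
    (hg : g ∈ Subgroup.Commensurable.commensurator A) (hu : u ∈ A) (hv : v ∈ A)
    (hne : ¬ Commute (u⁻¹ * v) g) :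
    AEDisjoint μ (MulAction.fixedBy X (u * g * u⁻¹)) (MulAction.fixedBy X (v * g * v⁻¹)) := by
  set c := u * (g⁻¹ * (u⁻¹ * v) * g * (u⁻¹ * v)⁻¹) * u⁻¹
  have hc : c ∈ quasiCentralizer A :=
    mul_mem (mul_mem (le_quasiCentralizer hu) (inv_mul_mul_mul_inv_mem_quasiCentralizer hg
      (mul_mem (inv_mem hu) hv))) (le_quasiCentralizer (inv_mem hu))
  have hc1 : c ≠ 1 := fun h => hne <| by
    rwa [conj_eq_one_iff, mul_inv_eq_one, mul_assoc, inv_mul_eq_iff_eq_mul] at h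
  refine measure_mono_null ?_ (hfree.measure_fixedBy_eq_zero hc hc1)
  rintro x ⟨hx, hx'⟩
  have : c = (u * g * u⁻¹)⁻¹ * (v * g * v⁻¹) := by simp only [c]; group
  rw [MulAction.mem_fixedBy] at hx hx' ⊢
  rw [this, mul_smul, hx', inv_smul_eq_iff, hx]

theorem EssentiallyFree.of_quasiCentralizer [MeasurableSpace.CountablySeparated X]
    [MeasurableConstSMul G X] [IsFiniteMeasure μ] [SMulInvariantMeasure G X μ] [IsMulCommutative A]
    (hA : Subgroup.Commensurable.commensurator A = ⊤)
    (hfree : EssentiallyFree (quasiCentralizer A) μ) : EssentiallyFree G μ := by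
  intro g hg1
  by_cases hg : g ∈ quasiCentralizer A
  · exact hfree.measure_fixedBy_eq_zero hg hg1
  let C := (Subgroup.centralizer {g}).subgroupOf A
  have : Infinite (A ⧸ C) := Subgroup.index_eq_zero_iff_infinite.1 <|
    not_not.1 (mem_quasiCentralizer_iff_relIndex_ne_zero.not.1 hg)
  let fix (q : A ⧸ C) : Set X := MulAction.fixedBy X ((q.out : G) * g * (q.out : G)⁻¹)
  have hmeas (q : A ⧸ C) : μ (fix q) = μ (MulAction.fixedBy X g) := by
    rw [← measure_smul μ (q.out : G) (MulAction.fixedBy X g), MulAction.smul_fixedBy]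
  have hdisj : Pairwise (Function.onFun (AEDisjoint μ) fix) := fun p q hpq => by
    refine hfree.aedisjoint_fixedBy_conj (hA ▸ Subgroup.mem_top g) p.out.2 q.out.2 fun h => hpq ?_
    rw [← p.out_eq, ← q.out_eq, Quotient.eq, QuotientGroup.leftRel_apply]
    exact Subgroup.mem_centralizer_singleton_iff.2 h
  by_contra hμ
  have hfin := Measure.finite_const_le_meas_of_disjoint_iUnion₀ μ (pos_iff_ne_zero.2 hμ) (As := fix)
    (fun q => (measurableSet_fixedBy _).nullMeasurableSet) hdisj (measure_ne_top _ _)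
  exact hfin.not_infinite (by simpa only [hmeas, le_refl, Set.ofPred_true] using Set.infinite_univ)

end EssentiallyFree

section Zpowers

variable {G : Type*} [Group G]

theorem relIndex_zpowers_zpow_ne_zero (g : G) {k : ℤ} (hk : k ≠ 0) :
    (Subgroup.zpowers (g ^ k)).relIndex (Subgroup.zpowers g) ≠ 0 := by
  have hindex : (Subgroup.zpowers (Multiplicative.ofAdd k)).index ≠ 0 := by
    change (AddSubgroup.zmultiples k).index ≠ 0
    rwa [Int.index_zmultiples, Int.natAbs_ne_zero]
  rw [← Subgroup.range_zpowersHom g, ← Subgroup.index_comap]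
  refine ne_zero_of_dvd_ne_zero hindex (Subgroup.index_dvd_of_le ?_)
  rw [Subgroup.zpowers_le]
  exact Subgroup.mem_zpowers (g ^ k)

theorem commensurable_zpowers_zpow (g : G) {k : ℤ} (hk : k ≠ 0) :
    Subgroup.Commensurable (Subgroup.zpowers (g ^ k)) (Subgroup.zpowers g) :=
  ⟨relIndex_zpowers_zpow_ne_zero g hk, by
    rw [Subgroup.relIndex_eq_one.2 (Subgroup.zpowers_le.2 (zpow_mem (Subgroup.mem_zpowers g) k))]
    exact one_ne_zero⟩

open scoped Pointwise in
theorem mem_commensurator_zpowers_of_conj_zpow {a g : G} {k l : ℤ} (hk : k ≠ 0) (hl : l ≠ 0)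
    (h : g * a ^ k * g⁻¹ = a ^ l) :
    g ∈ Subgroup.Commensurable.commensurator (Subgroup.zpowers a) := by
  have hconj : ConjAct.toConjAct g • Subgroup.zpowers (a ^ k) = Subgroup.zpowers (a ^ l) := by
    rw [← h, ← ConjAct.toConjAct_smul]
    exact MonoidHom.map_zpowers _ _
  have hak := (commensurable_zpowers_zpow a hk).symm.conj (ConjAct.toConjAct g)
  rw [hconj] at hak
  exact hak.trans (commensurable_zpowers_zpow a hl)

theorem exists_commute_pow_of_mem_quasiCentralizer_zpowers {a g : G}
    (hg : g ∈ quasiCentralizer (Subgroup.zpowers a)) : ∃ N : ℕ, N ≠ 0 ∧ Commute g (a ^ N) := by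
  obtain ⟨L, -, hL, hgL⟩ := hg
  obtain ⟨N, hN, -, haN⟩ :=
    Subgroup.exists_pow_mem_of_relIndex_ne_zero hL (Subgroup.mem_zpowers a)
  exact ⟨N, hN.ne', (Subgroup.mem_centralizer_iff.1 hgL _ haN.1).symm⟩

theorem commute_of_commute_pow_of_conj_mem_zpowers {a g x : G} {N : ℕ} (ha : ¬ IsOfFinOrder a)
    (hN : N ≠ 0) (hg : Commute g (a ^ N)) (hx : x ∈ Subgroup.zpowers a)
    (hgx : g * x * g⁻¹ ∈ Subgroup.zpowers a) : Commute g x := by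
  obtain ⟨i, rfl⟩ := Subgroup.mem_zpowers_iff.1 hx
  obtain ⟨j, hj⟩ := Subgroup.mem_zpowers_iff.1 hgx
  have hpow : a ^ (j * N) = a ^ (i * N) := by
    calc a ^ (j * N) = g * (a ^ N) ^ i * g⁻¹ := by
          rw [zpow_mul, hj, ← zpow_natCast a N, ← zpow_mul, mul_comm (N : ℤ), zpow_mul, conj_zpow]
      _ = a ^ (i * N) := by
          rw [(hg.zpow_right i).eq, mul_inv_cancel_right, ← zpow_natCast, ← zpow_mul, mul_comm]
  have hij : j = i :=
    mul_right_cancel₀ (Nat.cast_ne_zero.2 hN) (injective_zpow_iff_not_isOfFinOrder.2 ha hpow)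
  exact mul_inv_eq_iff_eq_mul.1 (hj.symm.trans (by rw [hij]))

end Zpowers

namespace BaumslagSolitar

variable (n m : ℤ)

/-- The generator `b` of `BS(n, m)`. -/
def b : BaumslagSolitar n m := PresentedGroup.of 1

theorem b_conj : b n m * a n m ^ n * (b n m)⁻¹ = a n m ^ m := by
  have := PresentedGroup.one_of_mem (rels := ({FreeGroup.of 1 * FreeGroup.of 0 ^ n *
    (FreeGroup.of 1)⁻¹ * (FreeGroup.of 0 ^ m)⁻¹} : Set (FreeGroup (Fin 2)))) rfl
  simp only [map_mul, map_inv, map_zpow] at this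
  exact mul_inv_eq_one.1 this

theorem closure_pair_a_b : Subgroup.closure {a n m, b n m} = ⊤ := by
  rw [← PresentedGroup.closure_range_of, Fin.range_fin_succ, Fin.tail_def,
    Set.range_unique]
  rfl

variable {n m}

/- In the affine action of `BS(n, m)` on `ℚ`, `a` is a nontrivial translation. -/
theorem not_isOfFinOrder_a (hn : n ≠ 0) (hm : m ≠ 0) : ¬ IsOfFinOrder (a n m) := by
  let f : Fin 2 → Equiv.Perm ℚ := ![Equiv.addRight 1, Equiv.mulLeft₀ (m / n : ℚ) (by positivity)]
  have hf : ∀ r ∈ ({FreeGroup.of 1 * FreeGroup.of 0 ^ n *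
      (FreeGroup.of 1)⁻¹ * (FreeGroup.of 0 ^ m)⁻¹} : Set (FreeGroup (Fin 2))),
      FreeGroup.lift f r = 1 := by
    rintro _ rfl
    simp only [map_mul, map_inv, map_zpow, FreeGroup.lift_apply_of]
    rw [mul_inv_eq_one, mul_inv_eq_iff_eq_mul]
    ext x
    have haffine : (m / n : ℚ) * (x + n) = m / n * x + m := by field_simp
    simpa [f] using haffine
  rw [← injective_zpow_iff_not_isOfFinOrder]
  intro i j hij
  have hperm : f 0 ^ i = f 0 ^ j := by
    simpa only [map_zpow, a, PresentedGroup.toGroup.of] using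
      congrArg (PresentedGroup.toGroup hf) hij
  simpa [f] using congrArg (fun e : Equiv.Perm ℚ => e 0) hperm

theorem commensurator_zpowers_a (hn : n ≠ 0) (hm : m ≠ 0) :
    Subgroup.Commensurable.commensurator (Subgroup.zpowers (a n m)) = ⊤ := by
  rw [eq_top_iff, ← closure_pair_a_b, Subgroup.closure_le, Set.pair_subset_iff]
  exact ⟨mem_commensurator_zpowers_of_conj_zpow one_ne_zero one_ne_zero (by simp),
    mem_commensurator_zpowers_of_conj_zpow hn hm (b_conj n m)⟩

variable (n m) in
/-- With `k = gcd(n, m)`, `n₀ = n / k` and `m₀ = m / k`, the subgroup of `BS(n, m)` generated by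
the power of `a` with exponent `k (n₀ m₀)ʳ`. Conjugation by a group element shifts this decreasing
filtration of `⟨a⟩` by a bounded amount. -/
def gcdPowSubgroup (r : ℕ) : Subgroup (BaumslagSolitar n m) :=
  Subgroup.zpowers (a n m ^ (Int.gcd n m * (n / Int.gcd n m * (m / Int.gcd n m)) ^ r : ℤ))

theorem gcdPowSubgroup_le_zpowers_a (r : ℕ) :
    gcdPowSubgroup n m r ≤ Subgroup.zpowers (a n m) :=
  Subgroup.zpowers_le.2 (zpow_mem (Subgroup.mem_zpowers _) _)

theorem conj_b_mem_gcdPowSubgroup {r : ℕ} {x : BaumslagSolitar n m}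
    (hx : x ∈ gcdPowSubgroup n m (r + 1)) :
    b n m * x * (b n m)⁻¹ ∈ gcdPowSubgroup n m r ∧
      (b n m)⁻¹ * x * b n m ∈ gcdPowSubgroup n m r := by
  obtain ⟨j, rfl⟩ := Subgroup.mem_zpowers_iff.1 hx
  obtain ⟨k, n₀, m₀, hk, hn₀, hm₀⟩ : ∃ k n₀ m₀ : ℤ,
    k = Int.gcd n m ∧ n₀ = n / k ∧ m₀ = m / k := ⟨_, _, _, rfl, rfl, rfl⟩
  have hn : n = k * n₀ := by rw [hn₀, hk, Int.mul_ediv_cancel' (Int.gcd_dvd_left ..)]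
  have hm : m = k * m₀ := by rw [hm₀, hk, Int.mul_ediv_cancel' (Int.gcd_dvd_right ..)]
  have hmem (i : ℤ) : a n m ^ (k * (n₀ * m₀) ^ r * i) ∈ gcdPowSubgroup n m r := by
    rw [zpow_mul, hm₀, hn₀, hk]
    exact zpow_mem (Subgroup.mem_zpowers _) i
  have hb (i : ℤ) : b n m * a n m ^ (n * i) * (b n m)⁻¹ = a n m ^ (m * i) := by
    rw [zpow_mul, zpow_mul, ← b_conj, conj_zpow]
  have hb' (i : ℤ) : (b n m)⁻¹ * a n m ^ (m * i) * b n m = a n m ^ (n * i) := by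
    rw [← hb]; group
  rw [← zpow_mul, ← hk, ← hn₀, ← hm₀]
  constructor
  · have he : k * (n₀ * m₀) ^ (r + 1) * j = n * (m₀ * (n₀ * m₀) ^ r * j) := by rw [hn]; ring
    have he' : m * (m₀ * (n₀ * m₀) ^ r * j) = k * (n₀ * m₀) ^ r * (m₀ ^ 2 * j) := by rw [hm]; ring
    rw [he, hb, he']
    exact hmem _
  · have he : k * (n₀ * m₀) ^ (r + 1) * j = m * (n₀ * (n₀ * m₀) ^ r * j) := by rw [hm]; ring
    have he' : n * (n₀ * (n₀ * m₀) ^ r * j) = k * (n₀ * m₀) ^ r * (n₀ ^ 2 * j) := by rw [hn]; ring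
    rw [he, hb', he']
    exact hmem _

theorem exists_conj_mem_gcdPowSubgroup (g : BaumslagSolitar n m) :
    ∃ d : ℕ, ∀ r : ℕ, ∀ x ∈ gcdPowSubgroup n m (r + d),
      g * x * g⁻¹ ∈ gcdPowSubgroup n m r ∧ g⁻¹ * x * g ∈ gcdPowSubgroup n m r := by
  induction (closure_pair_a_b n m ▸ Subgroup.mem_top g : g ∈ Subgroup.closure {a n m, b n m})
    using Subgroup.closure_induction with
  | mem g hg =>
    obtain rfl | rfl := hg
    · refine ⟨0, fun r x hx => ?_⟩
      have hcomm : Commute (a n m) x :=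
        setLike_mul_comm (Subgroup.mem_zpowers _) (gcdPowSubgroup_le_zpowers_a _ hx)
      exact ⟨by rwa [hcomm.mul_inv_cancel], by rwa [hcomm.inv_mul_cancel]⟩
    · exact ⟨1, fun r x => conj_b_mem_gcdPowSubgroup⟩
  | one => exact ⟨0, fun r x hx => by simpa using hx⟩
  | mul g h _ _ ihg ihh =>
    obtain ⟨d, hd⟩ := ihg
    obtain ⟨e, he⟩ := ihh
    refine ⟨d + e, fun r x hx => ⟨?_, ?_⟩⟩
    · simpa only [mul_inv_rev, mul_assoc] using (hd r _ (he (r + d) x (by rwa [add_assoc])).1).1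
    · simpa only [mul_inv_rev, mul_assoc] using
        (he r _ (hd (r + e) x (by rwa [add_right_comm, add_assoc])).2).2
  | inv g _ ih =>
    obtain ⟨d, hd⟩ := ih
    exact ⟨d, fun r x hx => by simpa only [inv_inv] using (hd r x hx).symm⟩

theorem exists_mem_indexSet_commute (hn : n ≠ 0) (hm : m ≠ 0) {g : BaumslagSolitar n m}
    (hg : g ∈ quasiCentralizer (Subgroup.zpowers (a n m))) :
    ∃ z ∈ indexSet n m, Commute g (a n m ^ z) := by
  obtain ⟨N, hN, hgN⟩ := exists_commute_pow_of_mem_quasiCentralizer_zpowers hg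
  obtain ⟨d, hd⟩ := exists_conj_mem_gcdPowSubgroup g
  set Z : ℤ := Int.gcd n m * (n / Int.gcd n m * (m / Int.gcd n m)) ^ (1 + d) with hZ
  have hgZ : Commute g (a n m ^ Z) :=
    commute_of_commute_pow_of_conj_mem_zpowers (not_isOfFinOrder_a hn hm) hN hgN
      (zpow_mem (Subgroup.mem_zpowers _) _)
      (gcdPowSubgroup_le_zpowers_a 1 (hd 1 _ (Subgroup.mem_zpowers _)).1)
  refine ⟨Z.natAbs, ⟨1 + d, 1 + d, by omega, ?_⟩, ?_⟩
  · simp [hZ, Int.natAbs_mul, Int.natAbs_pow, mul_pow, mul_assoc]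
  · rw [← zpow_natCast]
    rcases Int.natAbs_eq Z with h | h
    · rwa [← h]
    · rwa [h, zpow_neg, Commute.inv_right_iff] at hgZ

end BaumslagSolitar

section GeneratedVonNeumannAlgebra

variable {H : Type*} [NormedAddCommGroup H] [InnerProductSpace ℂ H] [CompleteSpace H]
  {S : Set (H →L[ℂ] H)}

theorem subset_generatedVonNeumannAlgebra :
    S ⊆ (generatedVonNeumannAlgebra S : Set (H →L[ℂ] H)) := by
  intro T hT
  refine (StarSubalgebra.mem_centralizer_iff ℂ).2 fun R hR => ?_
  exact ⟨((StarSubalgebra.mem_centralizer_iff ℂ).1 hR T hT).1.symm,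
    ((StarSubalgebra.mem_centralizer_iff ℂ).1 (star_mem hR) T hT).1.symm⟩

theorem mem_commutant_generatedVonNeumannAlgebra {R : H →L[ℂ] H} :
    R ∈ (generatedVonNeumannAlgebra S).commutant ↔
      ∀ T ∈ S, Commute T R ∧ Commute (star T) R := by
  rw [VonNeumannAlgebra.mem_commutant_iff]
  constructor
  · intro h T hT
    have := subset_generatedVonNeumannAlgebra hT
    exact ⟨h T this, h _ (star_mem this)⟩
  · intro h T hT
    exact (((StarSubalgebra.mem_centralizer_iff ℂ).1 hT R
      ((StarSubalgebra.mem_centralizer_iff ℂ).2 h)).1).symm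

/-- The inclusion `N ⊆ M` of von Neumann algebras is irreducible: the relative commutant `N' ∩ M`
is `ℂ1`. -/
def IsIrreducibleInclusion (N M : VonNeumannAlgebra H) : Prop :=
  (N.commutant : Set (H →L[ℂ] H)) ∩ (M : Set (H →L[ℂ] H)) =
    {T | ∃ c : ℂ, T = c • ContinuousLinearMap.id ℂ H}

theorem isIrreducibleInclusion_of_forall {N M : VonNeumannAlgebra H}
    (h : ∀ T ∈ N.commutant, T ∈ M → ∃ c : ℂ, T = c • ContinuousLinearMap.id ℂ H) :
    IsIrreducibleInclusion N M := by
  refine Set.Subset.antisymm (fun T hT => h T hT.1 hT.2) ?_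
  rintro _ ⟨c, rfl⟩
  exact ⟨N.commutant.toStarSubalgebra.smul_mem (one_mem _) c,
    M.toStarSubalgebra.smul_mem (one_mem _) c⟩

end GeneratedVonNeumannAlgebra

namespace CrossedProduct

section TensorTranslation

variable {G : Type*} [Group G] {E : Type*} [NormedAddCommGroup E] [InnerProductSpace ℂ E]

theorem tensorTranslation_mul (S T : E →L[ℂ] E) (h k : G) :
    tensorTranslation S h * tensorTranslation T k = tensorTranslation (S * T) (h * k) := by
  ext ξ g
  simp [mul_assoc]

theorem star_tensorTranslation [CompleteSpace E] (T : E →L[ℂ] E) (h : G) :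
    star (tensorTranslation T h) = tensorTranslation (star T) h⁻¹ := by
  rw [ContinuousLinearMap.star_eq_adjoint, eq_comm, ContinuousLinearMap.eq_adjoint_iff]
  intro ξ η
  rw [lp.inner_eq_tsum, lp.inner_eq_tsum, ← (Equiv.mulLeft h⁻¹).tsum_eq]
  refine tsum_congr fun g => ?_
  simp [ContinuousLinearMap.star_eq_adjoint, ContinuousLinearMap.adjoint_inner_left]

theorem tensorTranslation_single [DecidableEq G] (T : E →L[ℂ] E) (h k : G) (x : E) :
    tensorTranslation T h (lp.single 2 k x) = lp.single 2 (h * k) (T x) := by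
  ext1
  funext g
  obtain rfl | hg := eq_or_ne g (h * k)
  · simp
  · have : h⁻¹ * g ≠ k := fun h' => hg (by rw [← h', mul_inv_cancel_left])
    simp [hg, this]

/-- The right translation `1 ⊗ ρ_h` of `E ⊗ ℓ²(G)`: `((1 ⊗ ρ_h) ξ) g = ξ (g h)`. -/
noncomputable def rightTranslation (E : Type*) [NormedAddCommGroup E] [InnerProductSpace ℂ E]
    (h : G) : lp (fun _ : G => E) 2 →L[ℂ] lp (fun _ : G => E) 2 :=
  LinearIsometry.toContinuousLinearMap
    { toFun ξ := ⟨fun g => ξ (g * h), memℓp_gen <|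
        (Equiv.mulRight h).summable_iff.2 ((lp.memℓp ξ).summable (by norm_num))⟩
      map_add' _ _ := rfl
      map_smul' _ _ := rfl
      norm_map' ξ := by
        rw [lp.norm_eq_tsum_rpow (by norm_num), lp.norm_eq_tsum_rpow (by norm_num)]
        congr 1
        exact (Equiv.mulRight h).tsum_eq fun g => ‖ξ g‖ ^ (2 : ℝ≥0∞).toReal }

@[simp]
theorem rightTranslation_apply (h g : G) (ξ : lp (fun _ : G => E) 2) :
    rightTranslation E h ξ g = ξ (g * h) := rfl

theorem rightTranslation_single [DecidableEq G] (h k : G) (x : E) :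
    rightTranslation E h (lp.single 2 k x) = lp.single 2 (k * h⁻¹) x := by
  ext1
  funext g
  obtain rfl | hg := eq_or_ne g (k * h⁻¹)
  · simp
  · have : g * h ≠ k := fun h' => hg (by rw [← h', mul_inv_cancel_right])
    simp [hg, this]

theorem commute_tensorTranslation_rightTranslation (T : E →L[ℂ] E) (h k : G) :
    Commute (tensorTranslation T h) (rightTranslation E k) := by
  ext ξ g
  simp [mul_assoc]

theorem commute_tensorTranslation_mapCLM {T : E →L[ℂ] E} {k : G} {D : G → E →L[ℂ] E} {C : ℝ}
    (hC : 0 ≤ C) (hD : ∀ g, ‖D g‖ ≤ C) (hTD : ∀ g, T * D (k⁻¹ * g) = D g * T) :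
    Commute (tensorTranslation T k) (lp.mapCLM 2 D hC hD) := by
  ext ξ g
  exact DFunLike.congr_fun (hTD g) (ξ (k⁻¹ * g))

end TensorTranslation

section L2

variable {X : Type*} [MeasurableSpace X] {μ : Measure X}

theorem coeFn_mulOp (f : Lp ℂ ∞ μ) (ξ : Lp ℂ 2 μ) : mulOp f ξ =ᵐ[μ] fun x => f x * ξ x :=
  (ContinuousLinearMap.mul ℂ ℂ).coeFn_holder f ξ

theorem norm_mulOp_le (f : Lp ℂ ∞ μ) : ‖mulOp f‖ ≤ ‖f‖ := by
  refine ContinuousLinearMap.opNorm_le_bound _ (norm_nonneg f) fun ξ => ?_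
  refine ((ContinuousLinearMap.mul ℂ ℂ).norm_holder_apply_apply_le f ξ).trans ?_
  rw [mul_assoc]
  exact mul_le_of_le_one_left (by positivity) (ContinuousLinearMap.opNorm_mul_le ℂ ℂ)

theorem commute_mulOp (f f' : Lp ℂ ∞ μ) : Commute (mulOp f) (mulOp f') := by
  ext1 ξ
  apply Lp.ext
  filter_upwards [coeFn_mulOp f (mulOp f' ξ), coeFn_mulOp f' ξ, coeFn_mulOp f' (mulOp f ξ),
    coeFn_mulOp f ξ] with x h1 h2 h3 h4
  simp only [mul_apply_eq_comp, h1, h2, h3, h4, mul_left_comm]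

theorem star_mulOp (f : Lp ℂ ∞ μ) : star (mulOp f) = mulOp (star f) := by
  rw [ContinuousLinearMap.star_eq_adjoint, eq_comm, ContinuousLinearMap.eq_adjoint_iff]
  intro ξ η
  rw [L2.inner_def, L2.inner_def]
  refine integral_congr_ae ?_
  filter_upwards [coeFn_mulOp (star f) ξ, coeFn_mulOp f η, Lp.coeFn_star f] with x h1 h2 h3
  simp only [h1, h2, h3, Pi.star_apply, RCLike.inner_apply, map_mul, RCLike.star_def,
    RingHomCompTriple.comp_apply, RingHom.id_apply]
  ring

theorem coeFn_mulOp_const_one [IsFiniteMeasure μ] (f : Lp ℂ ∞ μ) :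
    mulOp f (Lp.const 2 μ 1) =ᵐ[μ] f := by
  filter_upwards [coeFn_mulOp f (Lp.const 2 μ 1), Lp.coeFn_const (p := 2) (μ := μ) (1 : ℂ)]
    with x h1 h2
  rw [h1, h2, Function.const_apply, mul_one]

theorem smul_const_one [IsFiniteMeasure μ] {p : ℝ≥0∞} (c : ℂ) :
    c • Lp.const p μ (1 : ℂ) = Lp.const p μ c := by
  rw [← Lp.constₗ_apply p μ ℂ, ← map_smul, smul_eq_mul, mul_one, Lp.constₗ_apply]

theorem denseRange_mulOp_const_one [IsFiniteMeasure μ] :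
    DenseRange fun f : Lp ℂ ∞ μ => mulOp f (Lp.const 2 μ 1) := by
  refine (Lp.simpleFunc.denseRange (E := ℂ) (μ := μ) (p := 2) (by norm_num)).mono ?_
  rintro _ ⟨φ, rfl⟩
  have hφ : MemLp (Lp.simpleFunc.toSimpleFunc φ) ∞ μ := SimpleFunc.memLp_top _ μ
  refine ⟨hφ.toLp _, Lp.ext ?_⟩
  exact (coeFn_mulOp_const_one _).trans
    (hφ.coeFn_toLp.trans (Lp.simpleFunc.toSimpleFunc_eq_toFun φ))

end L2

section Translate

variable {G : Type*} [Group G] {X : Type*} [MeasurableSpace X] {μ : Measure X} [MulAction G X]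
  [MeasurableConstSMul G X] [SMulInvariantMeasure G X μ] {p : ℝ≥0∞}

/-- The action `(σ_h f) x = f (h⁻¹ x)` of `G` on `L^p(X, μ)`; on `L²` it is `koopman`. -/
noncomputable def translate (h : G) (f : Lp ℂ p μ) : Lp ℂ p μ :=
  DomMulAct.mk h⁻¹ • f

theorem coeFn_translate (h : G) (f : Lp ℂ p μ) : translate h f =ᵐ[μ] fun x => f (h⁻¹ • x) :=
  DomMulAct.smul_Lp_ae_eq _ f

theorem norm_translate (h : G) (f : Lp ℂ p μ) : ‖translate h f‖ = ‖f‖ :=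
  DomMulAct.norm_smul_Lp _ f

theorem translate_one (f : Lp ℂ p μ) : translate (1 : G) f = f := by
  rw [translate, inv_one, DomMulAct.mk_one, one_smul]

theorem translate_mul (h k : G) (f : Lp ℂ p μ) :
    translate (h * k) f = translate h (translate k f) := by
  rw [translate, mul_inv_rev, DomMulAct.mk_mul, mul_smul, translate, translate]

theorem translate_indicatorConstLp {s : Set X} (hs : MeasurableSet s) (hμs : μ s ≠ ∞) {h : G}
    (hinv : (h⁻¹ • ·) ⁻¹' s =ᵐ[μ] s) (c : ℂ) :
    translate h (indicatorConstLp p hs hμs c) = indicatorConstLp p hs hμs c := by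
  rw [translate, DomMulAct.mk_smul_indicatorConstLp]
  exact Lp.ext (indicatorConstLp_coeFn.trans
    ((indicator_ae_eq_of_ae_eq_set hinv).trans indicatorConstLp_coeFn.symm))

theorem koopman_apply (h : G) (ξ : Lp ℂ 2 μ) : koopman μ h ξ = translate h ξ := rfl

theorem koopman_mul (h k : G) : koopman μ h * koopman μ k = koopman μ (h * k) :=
  ContinuousLinearMap.ext fun ξ => (translate_mul h k ξ).symm

theorem star_koopman (h : G) : star (koopman μ h) = koopman μ h⁻¹ := by
  rw [ContinuousLinearMap.star_eq_adjoint, eq_comm, ContinuousLinearMap.eq_adjoint_iff]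
  intro ξ η
  rw [← LinearIsometry.inner_map_map (Lp.compMeasurePreservingₗᵢ ℂ (fun x : X => h⁻¹ • x)
    (measurePreserving_smul h⁻¹ μ))]
  change inner ℂ (translate h (translate h⁻¹ ξ)) (koopman μ h η) = _
  rw [← translate_mul, mul_inv_cancel, translate_one]

theorem koopman_mul_mulOp (h : G) (f : Lp ℂ ∞ μ) :
    koopman μ h * mulOp f = mulOp (translate h f) * koopman μ h := by
  ext1 ξ
  apply Lp.ext
  have hae := (measurePreserving_smul h⁻¹ μ).quasiMeasurePreserving.ae (coeFn_mulOp f ξ)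
  filter_upwards [coeFn_translate h (mulOp f ξ), hae,
    coeFn_mulOp (translate h f) (koopman μ h ξ), coeFn_translate h f, coeFn_translate h ξ]
    with x h1 h2 h3 h4 h5
  simp only [mul_apply_eq_comp, koopman_apply] at h1 h2 h3 ⊢
  rw [h1, h2, h3, h4, h5]

theorem mulOp_mul_eq_mulOp_translate_mul {g : G} {f f' : Lp ℂ ∞ μ}
    (hf : ∀ᵐ x ∂μ, x ∉ MulAction.fixedBy X g → f x = 0) :
    mulOp f' * mulOp f = mulOp (translate g f') * mulOp f := by
  ext1 ξ
  apply Lp.ext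
  filter_upwards [coeFn_mulOp f' (mulOp f ξ), coeFn_mulOp (translate g f') (mulOp f ξ),
    coeFn_mulOp f ξ, coeFn_translate g f', hf] with x h1 h2 h3 h4 hfx
  simp only [mul_apply_eq_comp, h1, h2, h3, h4]
  by_cases hx : x ∈ MulAction.fixedBy X g
  · rw [inv_smul_eq_iff.2 (MulAction.mem_fixedBy.1 hx).symm]
  · rw [hfx hx, zero_mul, mul_zero, mul_zero]

theorem eq_zero_of_forall_mulOp_translate_eq [MeasurableSpace.CountablySeparated X]
    [IsFiniteMeasure μ] {g : G} (hg : μ (MulAction.fixedBy X g) = 0) {ξ : Lp ℂ 2 μ}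
    (h : ∀ f, mulOp f ξ = mulOp (translate g f) ξ) : ξ = 0 := by
  have hmem (s : Set X) (hs : MeasurableSet s) : ∀ᵐ x ∂μ, ξ x ≠ 0 → (g⁻¹ • x ∈ s ↔ x ∈ s) := by
    let f : Lp ℂ ∞ μ := indicatorConstLp ∞ hs (measure_ne_top μ s) 1
    have hf : f =ᵐ[μ] s.indicator 1 := indicatorConstLp_coeFn
    have hfg := (measurePreserving_smul g⁻¹ μ).quasiMeasurePreserving.ae hf
    have hξ := coeFn_mulOp f ξ
    rw [h f] at hξ
    filter_upwards [hξ, coeFn_mulOp (translate g f) ξ, coeFn_translate g f, hf, hfg]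
      with x h1 h2 h3 h4 h5 hx
    have heq : s.indicator (1 : X → ℂ) (g⁻¹ • x) = s.indicator 1 x := by
      rw [← h5, ← h4, ← h3]
      exact mul_right_cancel₀ hx (h2.symm.trans h1)
    rw [← Set.indicator_eq_one_iff_mem ℂ, heq, Set.indicator_eq_one_iff_mem]
  have hfix : ∀ᵐ x ∂μ, ξ x ≠ 0 → g⁻¹ • x = x :=
    Filter.eventually_inf_principal.1 <|
      Filter.EventuallyEq.of_forall_separating_preimage MeasurableSet
        (l := ae μ ⊓ Filter.principal {x | ξ x ≠ 0}) (f := (g⁻¹ • ·)) (g := id) fun s hs =>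
          (Filter.eventually_inf_principal.2 (hmem s hs)).set_eq
  rw [Lp.eq_zero_iff_ae_eq_zero]
  filter_upwards [hfix, measure_eq_zero_iff_ae_notMem.1 hg] with x hx hxg
  by_contra hne
  exact hxg (inv_smul_eq_iff.1 (hx hne)).symm

theorem ae_eq_const_of_forall_translate_eq {L : Subgroup G} [ErgodicSMul L X μ] {ξ : Lp ℂ p μ}
    (hξ : ∀ h ∈ L, translate h ξ = ξ) : ∃ c : ℂ, ξ =ᵐ[μ] fun _ => c := by
  refine Filter.exists_eventuallyEq_const_of_forall_separating MeasurableSet fun s hs => ?_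
  refine Filter.eventuallyConst_set.1 <| aeconst_of_forall_preimage_smul_ae_eq L (s := ξ ⁻¹' s)
    ((Lp.stronglyMeasurable ξ).measurable hs).nullMeasurableSet fun h => ?_
  have hinv := coeFn_translate (h⁻¹ : G) ξ
  rw [hξ _ (inv_mem h.2), inv_inv] at hinv
  exact hinv.symm.preimage s

end Translate

section Generators

variable {G : Type*} [Group G] {X : Type*} [MeasurableSpace X] {μ : Measure X}

theorem star_coeff (f : Lp ℂ ∞ μ) : star (coeff G f) = coeff G (star f) := by
  rw [coeff, star_tensorTranslation, star_mulOp, inv_one, coeff]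

theorem commute_coeff (f f' : Lp ℂ ∞ μ) : Commute (coeff G f) (coeff G f') := by
  rw [Commute, SemiconjBy, coeff, coeff, tensorTranslation_mul, tensorTranslation_mul,
    commute_mulOp]

variable [MulAction G X] [MeasurableConstSMul G X] [SMulInvariantMeasure G X μ]

theorem star_canonicalUnitary (h : G) : star (canonicalUnitary μ h) = canonicalUnitary μ h⁻¹ := by
  rw [canonicalUnitary, star_tensorTranslation, star_koopman, canonicalUnitary]

theorem canonicalUnitary_mul (h k : G) :
    canonicalUnitary μ h * canonicalUnitary μ k = canonicalUnitary μ (h * k) := by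
  rw [canonicalUnitary, canonicalUnitary, tensorTranslation_mul, koopman_mul, canonicalUnitary]

theorem canonicalUnitary_mul_coeff (h : G) (f : Lp ℂ ∞ μ) :
    canonicalUnitary μ h * coeff G f = coeff G (translate h f) * canonicalUnitary μ h := by
  rw [canonicalUnitary, coeff, coeff, tensorTranslation_mul, tensorTranslation_mul,
    koopman_mul_mulOp, mul_one, one_mul]

theorem coeff_mem_crossedProduct (f : Lp ℂ ∞ μ) (L : Subgroup G) :
    coeff G f ∈ crossedProduct μ L :=
  subset_generatedVonNeumannAlgebra (Or.inl ⟨f, rfl⟩)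

theorem canonicalUnitary_mem_crossedProduct {L : Subgroup G} {h : G} (hh : h ∈ L) :
    canonicalUnitary μ h ∈ crossedProduct μ L :=
  subset_generatedVonNeumannAlgebra (Or.inr ⟨h, hh, rfl⟩)

variable {L : Subgroup G}

theorem mem_commutant_crossedProduct {R : HilbertSpace G μ →L[ℂ] HilbertSpace G μ} :
    R ∈ (crossedProduct μ L).commutant ↔
      (∀ f, Commute (coeff G f) R) ∧ ∀ h ∈ L, Commute (canonicalUnitary μ h) R := by
  rw [crossedProduct, mem_commutant_generatedVonNeumannAlgebra]
  constructor
  · intro h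
    exact ⟨fun f => (h _ (Or.inl ⟨f, rfl⟩)).1, fun k hk => (h _ (Or.inr ⟨k, hk, rfl⟩)).1⟩
  · rintro ⟨h1, h2⟩ _ (⟨f, rfl⟩ | ⟨k, hk, rfl⟩)
    · exact ⟨h1 f, by rw [star_coeff]; exact h1 _⟩
    · exact ⟨h2 k hk, by rw [star_canonicalUnitary]; exact h2 _ (inv_mem hk)⟩

theorem rightTranslation_mem_commutant (h : G) :
    rightTranslation (Lp ℂ 2 μ) h ∈ (crossedProduct μ L).commutant :=
  mem_commutant_crossedProduct.2 ⟨fun _ => commute_tensorTranslation_rightTranslation _ _ _,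
    fun _ _ => commute_tensorTranslation_rightTranslation _ _ _⟩

/-- The right copy of `f ∈ L^∞(X, μ)` on `L²(X, μ) ⊗ ℓ²(G)`: multiplication by `σ_g f` on the
component at `g`. Together with the right translations these operators generate the commutant of
the crossed product. -/
noncomputable def rightCoeff (f : Lp ℂ ∞ μ) : HilbertSpace G μ →L[ℂ] HilbertSpace G μ :=
  lp.mapCLM 2 (fun g : G => mulOp (translate g f)) (norm_nonneg f)
    fun g => (norm_mulOp_le _).trans (norm_translate g f).le

@[simp]
theorem rightCoeff_apply (f : Lp ℂ ∞ μ) (ξ : HilbertSpace G μ) (g : G) :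
    rightCoeff f ξ g = mulOp (translate g f) (ξ g) := rfl

theorem rightCoeff_single [DecidableEq G] (f : Lp ℂ ∞ μ) (g : G) (ξ : Lp ℂ 2 μ) :
    rightCoeff f (lp.single 2 g ξ) = lp.single 2 g (mulOp (translate g f) ξ) := by
  ext1
  funext k
  obtain rfl | hk := eq_or_ne k g
  · simp
  · simp [hk]

theorem rightCoeff_mem_commutant (f : Lp ℂ ∞ μ) :
    rightCoeff f ∈ (crossedProduct μ L).commutant := by
  refine mem_commutant_crossedProduct.2 ⟨fun f' => ?_, fun h _ => ?_⟩
  · refine commute_tensorTranslation_mapCLM _ _ fun g => ?_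
    rw [inv_one, one_mul, commute_mulOp]
  · refine commute_tensorTranslation_mapCLM _ _ fun g => ?_
    rw [koopman_mul_mulOp, ← translate_mul, mul_inv_cancel_left]

end Generators

section Vacuum

variable {G : Type*} [Group G] [DecidableEq G] {X : Type*} [MeasurableSpace X] {μ : Measure X}
  [IsFiniteMeasure μ]

/-- The vector `1 ⊗ δ₁`, which is cyclic and separating for the crossed product. -/
noncomputable def vacuum (G : Type*) [Group G] [DecidableEq G] {X : Type*} [MeasurableSpace X]
    (μ : Measure X) [IsFiniteMeasure μ] : HilbertSpace G μ :=
  lp.single 2 1 (Lp.const 2 μ 1)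

theorem coeff_vacuum (f : Lp ℂ ∞ μ) :
    coeff G f (vacuum G μ) = lp.single 2 1 (mulOp f (Lp.const 2 μ 1)) := by
  rw [coeff, vacuum, tensorTranslation_single, one_mul]

variable [MulAction G X] [MeasurableConstSMul G X] [SMulInvariantMeasure G X μ]

theorem rightCoeff_vacuum (f : Lp ℂ ∞ μ) : rightCoeff f (vacuum G μ) = coeff G f (vacuum G μ) := by
  rw [coeff_vacuum, vacuum, rightCoeff_single, translate_one]

theorem canonicalUnitary_vacuum (h : G) :
    canonicalUnitary μ h (vacuum G μ) = lp.single 2 h (Lp.const 2 μ 1) := by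
  rw [canonicalUnitary, vacuum, tensorTranslation_single, mul_one]
  exact congrArg _ (DomMulAct.smul_Lp_const _ _)

theorem rightTranslation_vacuum (h : G) :
    rightTranslation _ h⁻¹ (vacuum G μ) = canonicalUnitary μ h (vacuum G μ) := by
  rw [canonicalUnitary_vacuum, vacuum, rightTranslation_single, one_mul, inv_inv]

-- The vacuum separates the points of the crossed product since it is cyclic for the commutant.
theorem eq_of_apply_vacuum_eq {S T : HilbertSpace G μ →L[ℂ] HilbertSpace G μ}
    (hS : S ∈ crossedProduct μ (⊤ : Subgroup G)) (hT : T ∈ crossedProduct μ (⊤ : Subgroup G))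
    (h : S (vacuum G μ) = T (vacuum G μ)) : S = T := by
  have hcomm {R : HilbertSpace G μ →L[ℂ] HilbertSpace G μ}
      (hR : R ∈ (crossedProduct μ (⊤ : Subgroup G)).commutant) {ξ : HilbertSpace G μ}
      (hξ : S ξ = T ξ) : S (R ξ) = T (R ξ) := by
    have hSR : S (R ξ) = R (S ξ) :=
      DFunLike.congr_fun (VonNeumannAlgebra.mem_commutant_iff.1 hR S hS) ξ
    have hTR : T (R ξ) = R (T ξ) :=
      DFunLike.congr_fun (VonNeumannAlgebra.mem_commutant_iff.1 hR T hT) ξ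
    rw [hSR, hTR, hξ]
  refine lp.ext_continuousLinearMap (by norm_num) fun g => ?_
  refine DFunLike.coe_injective (denseRange_mulOp_const_one.equalizer (by fun_prop) (by fun_prop)
    (funext fun f => ?_))
  have hgf : rightTranslation _ g⁻¹ (rightCoeff f (vacuum G μ)) =
      lp.single 2 g (mulOp f (Lp.const 2 μ 1)) := by
    rw [rightCoeff_vacuum, coeff_vacuum, rightTranslation_single, one_mul, inv_inv]
  have := hcomm (rightTranslation_mem_commutant g⁻¹) (hcomm (rightCoeff_mem_commutant f) h)
  rwa [hgf] at this

end Vacuum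

section Irreducible

variable {G : Type*} [Group G] {X : Type*} [MeasurableSpace X] {μ : Measure X} [IsFiniteMeasure μ]
  [MulAction G X] [MeasurableConstSMul G X] [SMulInvariantMeasure G X μ] {L : Subgroup G}

section FourierCoefficients

variable [DecidableEq G] {T : HilbertSpace G μ →L[ℂ] HilbertSpace G μ}

theorem apply_vacuum_eq_of_commute (hT : T ∈ crossedProduct μ (⊤ : Subgroup G))
    {R S : HilbertSpace G μ →L[ℂ] HilbertSpace G μ} (hST : Commute S T)
    (hR : R ∈ (crossedProduct μ (⊤ : Subgroup G)).commutant)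
    (h : R (vacuum G μ) = S (vacuum G μ)) : S (T (vacuum G μ)) = R (T (vacuum G μ)) :=
  calc S (T (vacuum G μ)) = T (S (vacuum G μ)) := DFunLike.congr_fun hST.eq _
    _ = T (R (vacuum G μ)) := by rw [h]
    _ = R (T (vacuum G μ)) := DFunLike.congr_fun (VonNeumannAlgebra.mem_commutant_iff.1 hR T hT) _

theorem mulOp_apply_vacuum (hT : T ∈ crossedProduct μ (⊤ : Subgroup G)) {f : Lp ℂ ∞ μ}
    (hfT : Commute (coeff G f) T) (g : G) :
    mulOp f (T (vacuum G μ) g) = mulOp (translate g f) (T (vacuum G μ) g) := by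
  have h := apply_vacuum_eq_of_commute hT hfT (rightCoeff_mem_commutant f) (rightCoeff_vacuum f)
  simpa [coeff] using congrArg (fun ξ : HilbertSpace G μ => ξ g) h

theorem translate_apply_vacuum_one (hT : T ∈ crossedProduct μ (⊤ : Subgroup G)) {h : G}
    (hhT : Commute (canonicalUnitary μ h) T) :
    translate h (T (vacuum G μ) 1) = T (vacuum G μ) 1 := by
  have := apply_vacuum_eq_of_commute hT hhT (rightTranslation_mem_commutant h⁻¹)
    (rightTranslation_vacuum h)
  simpa [canonicalUnitary, koopman_apply] using congrArg (fun ξ : HilbertSpace G μ => ξ h) this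

end FourierCoefficients

theorem isIrreducibleInclusion_of_essentiallyFree [MeasurableSpace.CountablySeparated X]
    [ErgodicSMul L X μ] (hfree : EssentiallyFree G μ) :
    IsIrreducibleInclusion (crossedProduct μ L) (crossedProduct μ (⊤ : Subgroup G)) := by
  classical
  refine isIrreducibleInclusion_of_forall fun T hT' hT => ?_
  obtain ⟨hcoeff, hunitary⟩ := mem_commutant_crossedProduct.1 hT'
  have hoff (g : G) (hg : g ≠ 1) : T (vacuum G μ) g = 0 :=
    eq_zero_of_forall_mulOp_translate_eq (hfree g hg) fun f => mulOp_apply_vacuum hT (hcoeff f) g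
  obtain ⟨c, hc⟩ := ae_eq_const_of_forall_translate_eq (L := L) (ξ := T (vacuum G μ) 1)
    fun h hh => translate_apply_vacuum_one hT (hunitary h hh)
  have hone : T (vacuum G μ) 1 = c • Lp.const 2 μ 1 := by
    rw [smul_const_one]
    exact Lp.ext (hc.trans (Lp.coeFn_const 2 μ c).symm)
  refine ⟨c, eq_of_apply_vacuum_eq hT
    ((crossedProduct μ ⊤).toStarSubalgebra.smul_mem (one_mem _) c) ?_⟩
  ext1
  funext g
  obtain rfl | hg := eq_or_ne g 1
  · simpa [vacuum] using hone
  · rw [hoff g hg]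
    simp [vacuum, hg]

theorem ergodicSMul_of_isIrreducibleInclusion
    (hL : IsIrreducibleInclusion (crossedProduct μ L) (crossedProduct μ (⊤ : Subgroup G))) :
    ErgodicSMul L X μ := by
  classical
  refine ⟨fun {s} hs hinv => ?_⟩
  let f : Lp ℂ ∞ μ := indicatorConstLp ∞ hs (measure_ne_top μ s) 1
  have hf : coeff G f ∈ (crossedProduct μ L).commutant := by
    refine mem_commutant_crossedProduct.2 ⟨fun _ => commute_coeff _ _, fun h hh => ?_⟩
    have hfh : translate h f = f := translate_indicatorConstLp hs _ (hinv ⟨h⁻¹, inv_mem hh⟩) 1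
    rw [Commute, SemiconjBy, canonicalUnitary_mul_coeff, hfh]
  obtain ⟨c, hc⟩ := hL.subset ⟨hf, coeff_mem_crossedProduct f ⊤⟩
  have hvac : mulOp f (Lp.const 2 μ 1) = c • Lp.const 2 μ 1 := by
    have := congrArg (fun ξ : HilbertSpace G μ => ξ 1) (DFunLike.congr_fun hc (vacuum G μ))
    rw [coeff_vacuum] at this
    simpa [vacuum] using this
  have hfc : s.indicator (fun _ => (1 : ℂ)) =ᵐ[μ] fun _ => c :=
    calc s.indicator (fun _ => (1 : ℂ)) =ᵐ[μ] f := indicatorConstLp_coeFn.symm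
      _ =ᵐ[μ] mulOp f (Lp.const 2 μ 1) := (coeFn_mulOp_const_one f).symm
      _ =ᵐ[μ] fun _ => c := by rw [hvac, smul_const_one]; exact Lp.coeFn_const 2 μ c
  exact (Filter.eventuallyConst_iff_exists_eventuallyEq.2 ⟨c, hfc⟩).of_indicator_const one_ne_zero

theorem coeff_indicator_fixedBy_mul_canonicalUnitary_mem_commutant {g : G}
    (hgL : g ∈ Subgroup.centralizer (L : Set G)) (hs : MeasurableSet (MulAction.fixedBy X g)) :
    coeff G (indicatorConstLp ∞ hs (measure_ne_top μ _) (1 : ℂ)) * canonicalUnitary μ g ∈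
      (crossedProduct μ L).commutant := by
  set f : Lp ℂ ∞ μ := indicatorConstLp ∞ hs (measure_ne_top μ _) 1
  refine mem_commutant_crossedProduct.2 ⟨fun f' => ?_, fun h hh => ?_⟩
  · have hfix : ∀ᵐ x ∂μ, x ∉ MulAction.fixedBy X g → f x = 0 := indicatorConstLp_coeFn_notMem
    have hmul : coeff G f' * coeff G f = coeff G f * coeff G (translate g f') := by
      rw [commute_coeff f, coeff, coeff, coeff, tensorTranslation_mul, tensorTranslation_mul,
        mulOp_mul_eq_mulOp_translate_mul hfix]
    rw [Commute, SemiconjBy, ← mul_assoc, hmul, mul_assoc, mul_assoc, canonicalUnitary_mul_coeff]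
  · have hgh : g * h = h * g := (Subgroup.mem_centralizer_iff.1 hgL h hh).symm
    have hinv : (h⁻¹ • ·) ⁻¹' MulAction.fixedBy X g = MulAction.fixedBy X g := by
      rw [Set.preimage_smul_inv, MulAction.smul_fixedBy, ← hgh, mul_inv_cancel_right]
    have hfh : translate h f = f := translate_indicatorConstLp hs _ hinv.eventuallyEq 1
    rw [Commute, SemiconjBy, ← mul_assoc, canonicalUnitary_mul_coeff, hfh, mul_assoc, mul_assoc,
      canonicalUnitary_mul, canonicalUnitary_mul, hgh]

theorem measure_fixedBy_eq_zero_of_isIrreducibleInclusion [MeasurableSpace.CountablySeparated X]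
    (hL : IsIrreducibleInclusion (crossedProduct μ L) (crossedProduct μ (⊤ : Subgroup G)))
    {g : G} (hg : g ≠ 1) (hgL : g ∈ Subgroup.centralizer (L : Set G)) :
    μ (MulAction.fixedBy X g) = 0 := by
  classical
  have hs := measurableSet_fixedBy (X := X) g
  let f : Lp ℂ ∞ μ := indicatorConstLp ∞ hs (measure_ne_top μ _) 1
  obtain ⟨c, hc⟩ := hL.subset
    ⟨coeff_indicator_fixedBy_mul_canonicalUnitary_mem_commutant hgL hs,
      mul_mem (coeff_mem_crossedProduct f ⊤)
        (canonicalUnitary_mem_crossedProduct (Subgroup.mem_top g))⟩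
  have hvac : mulOp f (Lp.const 2 μ 1) = 0 := by
    have := congrArg (fun ξ : HilbertSpace G μ => ξ g) (DFunLike.congr_fun hc (vacuum G μ))
    rw [mul_apply_eq_comp, canonicalUnitary_vacuum, coeff, tensorTranslation_single] at this
    simpa [vacuum, hg] using this
  have hf := coeFn_mulOp_const_one f
  rw [hvac] at hf
  rw [measure_eq_zero_iff_ae_notMem]
  filter_upwards [hf, Lp.coeFn_zero ℂ 2 μ,
    indicatorConstLp_coeFn_mem (p := ∞) (hs := hs) (hμs := measure_ne_top μ _) (c := (1 : ℂ))]
    with x h1 h2 h3 hx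
  rw [← h1, h2] at h3
  exact zero_ne_one (h3 hx)

theorem tfae_isIrreducibleInclusion_essentiallyFree [MeasurableSpace.CountablySeparated X]
    {A : Subgroup G} [IsMulCommutative A] (hA : Subgroup.Commensurable.commensurator A = ⊤)
    {ι : Type*} {F : Set ι} {L : ι → Subgroup G}
    (hL : ∀ g ∈ quasiCentralizer A, ∃ z ∈ F, g ∈ Subgroup.centralizer (L z : Set G)) :
    List.TFAE [
      ∀ z ∈ F, IsIrreducibleInclusion (crossedProduct μ (L z)) (crossedProduct μ (⊤ : Subgroup G)),
      EssentiallyFree (quasiCentralizer A) μ ∧ ∀ z ∈ F, ErgodicSMul (L z) X μ,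
      EssentiallyFree G μ ∧ ∀ z ∈ F, ErgodicSMul (L z) X μ] := by
  tfae_have 1 → 2 := fun h => by
    refine ⟨fun g hg => ?_, fun z hz => ergodicSMul_of_isIrreducibleInclusion (h z hz)⟩
    obtain ⟨z, hz, hgz⟩ := hL g g.2
    exact measure_fixedBy_eq_zero_of_isIrreducibleInclusion (h z hz)
      (OneMemClass.coe_eq_one.not.2 hg) hgz
  tfae_have 2 → 3 := fun h => ⟨EssentiallyFree.of_quasiCentralizer hA h.1, h.2⟩
  tfae_have 3 → 1 := fun h z hz =>
    have := h.2 z hz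
    isIrreducibleInclusion_of_essentiallyFree h.1
  tfae_finish

end Irreducible

end CrossedProduct

theorem lemma5p1_general {n m : ℤ} (hn : n ≠ 0) (hm : m ≠ 0)
    {X : Type*} [MeasurableSpace X] [MeasurableSpace.CountablySeparated X]
    (μ : Measure X) [IsFiniteMeasure μ]
    [MulAction (BaumslagSolitar n m) X] [MeasurableConstSMul (BaumslagSolitar n m) X]
    [SMulInvariantMeasure (BaumslagSolitar n m) X μ] :
    List.TFAE [
      ∀ z ∈ indexSet n m, IsIrreducibleInclusion
        (CrossedProduct.crossedProduct μ (Subgroup.zpowers (BaumslagSolitar.a n m ^ z)))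
        (CrossedProduct.crossedProduct μ (⊤ : Subgroup (BaumslagSolitar n m))),
      EssentiallyFree (quasiCentralizer (Subgroup.zpowers (BaumslagSolitar.a n m))) μ ∧
        ∀ z ∈ indexSet n m, ErgodicSMul (Subgroup.zpowers (BaumslagSolitar.a n m ^ z)) X μ,
      EssentiallyFree (BaumslagSolitar n m) μ ∧
        ∀ z ∈ indexSet n m, ErgodicSMul (Subgroup.zpowers (BaumslagSolitar.a n m ^ z)) X μ] := by
  refine CrossedProduct.tfae_isIrreducibleInclusion_essentiallyFree
    (BaumslagSolitar.commensurator_zpowers_a hn hm) fun g hg => ?_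
  obtain ⟨z, hz, hgz⟩ := BaumslagSolitar.exists_mem_indexSet_commute hn hm hg
  refine ⟨z, hz, Subgroup.mem_centralizer_iff.2 ?_⟩
  rintro _ ⟨j, rfl⟩
  exact (hgz.zpow_right j).eq.symm

theorem lemma5p1 (n m : ℤ) (hn : 2 ≤ n) (hnm : n ≤ |m|)
    {X : Type*} [MeasurableSpace X] [StandardBorelSpace X]
    (μ : Measure X) [IsProbabilityMeasure μ]
    [MulAction (BaumslagSolitar n m) X] [MeasurableConstSMul (BaumslagSolitar n m) X]
    [SMulInvariantMeasure (BaumslagSolitar n m) X μ] :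
    List.TFAE [
      ∀ z ∈ indexSet n m,
        ((CrossedProduct.crossedProduct μ
            (Subgroup.zpowers (BaumslagSolitar.a n m ^ z))).commutant : Set _) ∩
          (CrossedProduct.crossedProduct μ (⊤ : Subgroup (BaumslagSolitar n m)) : Set _) =
        {T | ∃ c : ℂ, T = c • ContinuousLinearMap.id ℂ
          (CrossedProduct.HilbertSpace (BaumslagSolitar n m) μ)},
      EssentiallyFree (quasiCentralizer (Subgroup.zpowers (BaumslagSolitar.a n m))) μ ∧
        ∀ z ∈ indexSet n m, ErgodicSMul (Subgroup.zpowers (BaumslagSolitar.a n m ^ z)) X μ,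
      EssentiallyFree (BaumslagSolitar n m) μ ∧
        ∀ z ∈ indexSet n m, ErgodicSMul (Subgroup.zpowers (BaumslagSolitar.a n m ^ z)) X μ] := by
  have hm : m ≠ 0 := abs_pos.1 (by omega)
  exact lemma5p1_general (by omega) hm μ
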